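/- Let $\mathcal H$ be an infinite-dimensional separable complex Hilbert space and let $r\in(0,1)$. For a bounded operator $T$ on $\mathcal H$ let $\|T\|_1=\operatorname{tr}|T|\in[0,\infty]$ be its trace norm, and let $E(\mathcal H)$ be the set of states on $\mathcal H$, that is, of positive bounded operators $Q$ with $\operatorname{tr}Q=1$. For $Q\in E(\mathcal H)$ put $$I_r(Q)=\|Q^r\|_1\in[0,\infty].$$ Then $I_r(Q)=\operatorname{tr}Q^r=\sum_\lambda\lambda^r$ for every $Q\in E(\mathcal H)$, the sum running over the positive eigenvalues of $Q$ counted with multiplicity, and the set $$\{Q\in E(\mathcal H): I_r(Q)=\infty\}$$ is dense in $E(\mathcal H)$ for the trace norm: for every $Q\in E(\mathcal H)$ and every $\varepsilon>0$ there is $Q'\in E(\mathcal H)$ with $I_r(Q')=\infty$ and $\|Q'-Q\|_1<\varepsilon$. -/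

import Mathlib

open scoped ENNReal InnerProductSpace

noncomputable section

/-- The index set (a set of vectors) of a fixed orthonormal Hilbert basis of `H`. -/
def onbSet (H : Type*) [NormedAddCommGroup H] [InnerProductSpace ℂ H] [CompleteSpace H] : Set H :=
  (exists_hilbertBasis ℂ H).choose

/-- A fixed orthonormal Hilbert basis of `H`. -/
def onb (H : Type*) [NormedAddCommGroup H] [InnerProductSpace ℂ H] [CompleteSpace H] :
    HilbertBasis (onbSet H) ℂ H :=
  (exists_hilbertBasis ℂ H).choose_spec.choose

/-- The trace `∑ᵢ ⟨eᵢ, T eᵢ⟩ ∈ [0, ∞]` of a positive operator `T`. The value does not depend on the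
orthonormal basis, see `posTrace_eq_tsum`. -/
def posTrace {H : Type*} [NormedAddCommGroup H] [InnerProductSpace ℂ H] [CompleteSpace H]
    (T : H →L[ℂ] H) : ℝ≥0∞ :=
  ∑' i, ENNReal.ofReal (inner ℂ (onb H i) (T (onb H i))).re

/-- Parseval's identity with values in `[0, ∞]`. -/
theorem tsum_enorm_inner_sq {H : Type*} [NormedAddCommGroup H] [InnerProductSpace ℂ H]
    {ι : Type*} (b : HilbertBasis ι ℂ H) (x : H) :
    ∑' i, ENNReal.ofReal (‖inner ℂ (b i) x‖ ^ 2) = ENNReal.ofReal (‖x‖ ^ 2) := by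
  have h : HasSum (fun i => ‖inner ℂ (b i) x‖ ^ 2) (‖x‖ ^ 2) := by
    have h1 := (b.hasSum_inner_mul_inner x x).mapL Complex.reCLM
    rw [inner_self_eq_norm_sq_to_K] at h1
    convert h1 using 1
    · ext i
      rw [← inner_conj_symm x (b i), Complex.reCLM_apply, mul_comm, Complex.mul_conj,
        Complex.ofReal_re, Complex.normSq_eq_norm_sq]
    · rw [Complex.reCLM_apply]
      norm_cast
  rw [← h.tsum_eq, ENNReal.ofReal_tsum_of_nonneg (fun i => by positivity) h.summable]

/-- The trace of a positive operator can be computed in every orthonormal basis. -/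
theorem posTrace_eq_tsum {H : Type*} [NormedAddCommGroup H] [InnerProductSpace ℂ H]
    [CompleteSpace H] {ι : Type*} (b : HilbertBasis ι ℂ H) {T : H →L[ℂ] H} (hT : 0 ≤ T) :
    posTrace T = ∑' i, ENNReal.ofReal (inner ℂ (b i) (T (b i))).re := by
  have hS : ∀ x y : H, inner ℂ x (CFC.sqrt T y) = inner ℂ (CFC.sqrt T x) y := by
    intro x y
    have h := ((ContinuousLinearMap.nonneg_iff_isPositive _).1 (CFC.sqrt_nonneg T)).isSymmetric
    exact (h x y).symm
  have key : ∀ x : H, (inner ℂ x (T x)).re = ‖CFC.sqrt T x‖ ^ 2 := by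
    intro x
    have h : T x = CFC.sqrt T (CFC.sqrt T x) := by
      conv_lhs => rw [← CFC.sqrt_mul_sqrt_self T hT]
      rfl
    rw [h, hS, inner_self_eq_norm_sq_to_K]
    norm_cast
  unfold posTrace
  simp_rw [key]
  calc ∑' i, ENNReal.ofReal (‖CFC.sqrt T (onb H i)‖ ^ 2)
      = ∑' i, ∑' j, ENNReal.ofReal (‖inner ℂ (b j) (CFC.sqrt T (onb H i))‖ ^ 2) := by
        simp_rw [tsum_enorm_inner_sq b]
    _ = ∑' j, ∑' i, ENNReal.ofReal (‖inner ℂ (b j) (CFC.sqrt T (onb H i))‖ ^ 2) :=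
        ENNReal.tsum_comm
    _ = ∑' j, ∑' i, ENNReal.ofReal (‖inner ℂ (onb H i) (CFC.sqrt T (b j))‖ ^ 2) := by
        refine tsum_congr fun j => tsum_congr fun i => ?_
        rw [hS, norm_inner_symm]
    _ = ∑' j, ENNReal.ofReal (‖CFC.sqrt T (b j)‖ ^ 2) := by
        simp_rw [tsum_enorm_inner_sq (onb H)]

/-- The trace norm `‖T‖₁ = tr |T| ∈ [0, ∞]`; it is finite exactly for the trace-class operators. -/
def traceNorm {H : Type*} [NormedAddCommGroup H] [InnerProductSpace ℂ H] [CompleteSpace H]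
    (T : H →L[ℂ] H) : ℝ≥0∞ :=
  posTrace (CFC.abs T)

/-- A state (density operator): a positive operator of trace one. -/
def IsState {H : Type*} [NormedAddCommGroup H] [InnerProductSpace ℂ H] [CompleteSpace H]
    (Q : H →L[ℂ] H) : Prop :=
  Q.IsPositive ∧ posTrace Q = 1

/-- `I_r(Q) = ‖Q ^ r‖₁ ∈ [0, ∞]`, where `Q ^ r` is given by the functional calculus. -/
def schattenMoment {H : Type*} [NormedAddCommGroup H] [InnerProductSpace ℂ H] [CompleteSpace H]
    (r : ℝ) (Q : H →L[ℂ] H) : ℝ≥0∞ :=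
  traceNorm (Q ^ r)

/-- `∑ λ ^ r` over the positive eigenvalues `λ` of `Q`, each counted with its multiplicity
`dim ker (Q - λ)` (which is finite when `Q` is a state, as states are compact operators). -/
def eigenvalueSum {H : Type*} [NormedAddCommGroup H] [InnerProductSpace ℂ H]
    (r : ℝ) (Q : H →L[ℂ] H) : ℝ≥0∞ :=
  ∑' μ : {μ : ℝ // 0 < μ},
    (Module.finrank ℂ (Module.End.eigenspace (Q : H →ₗ[ℂ] H) ((μ : ℝ) : ℂ)) : ℝ≥0∞) *
      ENNReal.ofReal ((μ : ℝ) ^ r)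

end

/-! A state has finite trace, so its square root is Hilbert-Schmidt and the state itself is compact
(`isCompactOperator_of_posTrace_ne_top`). It is therefore diagonal in an orthonormal eigenbasis
(`exists_hilbertBasis_diagonal`). The functional calculus acts on an eigenvector through its
eigenvalue, so traces, powers and trace norms become sums over diagonal entries. The trace formula
is then a regrouping of the basis by eigenspaces.

For density, fix an eigenbasis of `Q` and let `S` be the diagonal state in that basis with weights
proportional to `n ^ (-1/r)` along a sequence of basis vectors. These are summable because `1/r >
1`, while their `r`-th powers form a harmonic series. The state `(1 - t)Q + tS` is within `2t` of
`Q` in trace norm, and its entries dominate those of `tS`, so its moment diverges for every `t > 0`.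
-/

/-! ### Diagonal operators and functional calculus on eigenvectors -/

section Diagonal

variable {H : Type*} [NormedAddCommGroup H] [InnerProductSpace ℂ H]

/-- A real eigenvalue of a bounded operator lies in its real spectrum. -/
theorem mem_spectrum_real_of_apply_eq_smul {T : H →L[ℂ] H} {x : H} (hx : x ≠ 0) {c : ℝ}
    (h : T x = (c : ℂ) • x) : c ∈ spectrum ℝ T := by
  rw [spectrum.mem_iff]
  intro hu
  obtain ⟨u, hu⟩ := hu
  have h1 : (algebraMap ℝ (H →L[ℂ] H) c - T) x = 0 := by
    rw [Algebra.algebraMap_eq_smul_one]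
    simp [h]
  have h2 : ((u⁻¹ : (H →L[ℂ] H)ˣ) : H →L[ℂ] H) ((u : H →L[ℂ] H) x) = x := by
    exact congrArg (fun S : H →L[ℂ] H => S x) u.inv_mul
  rw [hu, h1, map_zero] at h2
  exact hx h2.symm

theorem HilbertBasis.ne_zero {ι : Type*} (b : HilbertBasis ι ℂ H) (i : ι) : b i ≠ 0 :=
  b.orthonormal.ne_zero i

/-- A diagonal operator with nonnegative entries is positive. -/
theorem isPositive_of_diagonal {ι : Type*} (b : HilbertBasis ι ℂ H) {T : H →L[ℂ] H}
    {c : ι → ℝ} (hc : ∀ i, 0 ≤ c i) (h : ∀ i, T (b i) = (c i : ℂ) • b i) : T.IsPositive := by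
  have key : ∀ x, HasSum (fun i => ((c i * ‖b.repr x i‖ ^ 2 : ℝ) : ℂ)) (inner ℂ x (T x)) := by
    intro x
    have h1 := ((b.hasSum_repr x).mapL T).mapL (innerSL ℂ x)
    simp only [innerSL_apply_apply] at h1
    have heq : (fun i => ((c i * ‖b.repr x i‖ ^ 2 : ℝ) : ℂ)) =
        fun i => inner ℂ x (T (b.repr x i • b i)) := by
      funext i
      rw [map_smul, h, inner_smul_right, inner_smul_right, ← inner_conj_symm,
        ← b.repr_apply_apply]
      push_cast
      rw [← Complex.mul_conj']
      ring
    rwa [heq]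
  rw [ContinuousLinearMap.isPositive_iff_complex]
  intro x
  have hre := Complex.hasSum_re (key x)
  simp only [Complex.ofReal_re] at hre
  have h2 : inner ℂ x (T x) = ((inner ℂ x (T x)).re : ℂ) :=
    (key x).unique (Complex.hasSum_ofReal.2 hre)
  have h3 : 0 ≤ (inner ℂ x (T x)).re :=
    hre.nonneg fun i => mul_nonneg (hc i) (sq_nonneg _)
  have h4 : inner ℂ (T x) x = ((inner ℂ x (T x)).re : ℂ) := by
    rw [← inner_conj_symm]
    conv_lhs => rw [h2]
    exact Complex.conj_ofReal _
  rw [h4]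
  exact ⟨by simp, by simpa using h3⟩

variable [CompleteSpace H]

/-- The continuous functional calculus acts on an eigenvector through the eigenvalue. -/
theorem cfc_real_apply_of_apply_eq_smul {T : H →L[ℂ] H} (hT : IsSelfAdjoint T) {x : H} (hx : x ≠ 0)
    {c : ℝ} (h : T x = (c : ℂ) • x) {f : ℝ → ℝ} (hf : ContinuousOn f (spectrum ℝ T)) :
    cfc f T x = (f c : ℂ) • x := by
  have hc := mem_spectrum_real_of_apply_eq_smul hx h
  -- Stone-Weierstrass: the identity holds for constants and the coordinate function, and passes to
  -- sums, products and uniform limits.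
  have key : ∀ g : C(spectrum ℝ T, ℝ), cfcHom hT g x = (g ⟨c, hc⟩ : ℂ) • x := by
    intro g
    induction g using ContinuousMap.induction_on_of_compact with
    | const a =>
      have : ContinuousMap.const (spectrum ℝ T) a = algebraMap ℝ C(spectrum ℝ T, ℝ) a := rfl
      rw [this, AlgHomClass.commutes, Algebra.algebraMap_eq_smul_one]
      simp [Algebra.algebraMap_eq_smul_one]
    | id => simp [cfcHom_id hT, h]
    | star_id => simp [cfcHom_id hT, h]
    | add f g hf hg => simp [map_add, hf, hg, add_smul]
    | mul f g hf hg =>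
      rw [map_mul, mul_apply_eq_comp, hg,
        map_smul, hf, smul_smul, ContinuousMap.mul_apply, Complex.ofReal_mul, mul_comm]
    | frequently f hf =>
      have hcl : IsClosed {g : C(spectrum ℝ T, ℝ) | cfcHom hT g x = (g ⟨c, hc⟩ : ℂ) • x} := by
        refine isClosed_eq ?_ ?_
        · exact (ContinuousLinearMap.apply ℂ H x).continuous.comp (cfcHom_continuous hT)
        · exact (Complex.continuous_ofReal.comp (continuous_eval_const _)).smul
            continuous_const
      exact hcl.closure_subset (mem_closure_iff_frequently.2 hf)
  rw [cfc_apply f T hT hf]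
  exact key _

/-- Powers of a positive operator act on eigenvectors through the powers of the eigenvalue. -/
theorem rpow_apply_of_apply_eq_smul {T : H →L[ℂ] H} (hT : 0 ≤ T) {x : H} (hx : x ≠ 0)
    {c : ℝ} (h : T x = (c : ℂ) • x) {r : ℝ} (hr : 0 ≤ r) :
    (T ^ r) x = ((c ^ r : ℝ) : ℂ) • x := by
  rw [CFC.rpow_eq_cfc_real hT]
  exact cfc_real_apply_of_apply_eq_smul (f := fun t => t ^ r) (IsSelfAdjoint.of_nonneg hT) hx h
    (Real.continuous_rpow_const hr).continuousOn

/-- The absolute value of a self-adjoint operator acts on eigenvectors through the absolute value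
of the eigenvalue. -/
theorem cfcAbs_apply_of_apply_eq_smul {T : H →L[ℂ] H} (hT : IsSelfAdjoint T) {x : H} (hx : x ≠ 0)
    {c : ℝ} (h : T x = (c : ℂ) • x) : CFC.abs T x = ((|c| : ℝ) : ℂ) • x := by
  rw [CFC.abs_eq_cfc_norm T hT]
  exact cfc_real_apply_of_apply_eq_smul (f := fun t => ‖t‖) hT hx h continuous_norm.continuousOn

/-- The trace of a positive diagonal operator is the sum of its diagonal entries. -/
theorem posTrace_eq_tsum_of_diagonal {ι : Type*} (b : HilbertBasis ι ℂ H) {T : H →L[ℂ] H}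
    (hT : 0 ≤ T) {c : ι → ℝ} (h : ∀ i, T (b i) = (c i : ℂ) • b i) :
    posTrace T = ∑' i, ENNReal.ofReal (c i) := by
  rw [posTrace_eq_tsum b hT]
  refine tsum_congr fun i => ?_
  rw [h, inner_smul_right, inner_self_eq_norm_sq_to_K, b.orthonormal.1 i]
  simp

/-- The trace norm of a self-adjoint diagonal operator. -/
theorem traceNorm_eq_tsum_of_diagonal {ι : Type*} (b : HilbertBasis ι ℂ H) {T : H →L[ℂ] H}
    (hT : IsSelfAdjoint T) {c : ι → ℝ} (h : ∀ i, T (b i) = (c i : ℂ) • b i) :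
    traceNorm T = ∑' i, ENNReal.ofReal |c i| :=
  posTrace_eq_tsum_of_diagonal b (CFC.abs_nonneg T)
    fun i => cfcAbs_apply_of_apply_eq_smul hT (b.ne_zero i) (h i)

theorem traceNorm_eq_posTrace {T : H →L[ℂ] H} (hT : 0 ≤ T) : traceNorm T = posTrace T := by
  rw [traceNorm, CFC.abs_of_nonneg T hT]

theorem schattenMoment_eq_posTrace (r : ℝ) (Q : H →L[ℂ] H) :
    schattenMoment r Q = posTrace (Q ^ r) :=
  traceNorm_eq_posTrace CFC.rpow_nonneg

theorem schattenMoment_eq_tsum_of_diagonal {ι : Type*} (b : HilbertBasis ι ℂ H) {T : H →L[ℂ] H}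
    (hT : 0 ≤ T) {c : ι → ℝ} (h : ∀ i, T (b i) = (c i : ℂ) • b i) {r : ℝ} (hr : 0 ≤ r) :
    schattenMoment r T = ∑' i, ENNReal.ofReal (c i ^ r) := by
  rw [schattenMoment_eq_posTrace]
  exact posTrace_eq_tsum_of_diagonal b CFC.rpow_nonneg
    fun i => rpow_apply_of_apply_eq_smul hT (b.ne_zero i) (h i) hr

end Diagonal

/-! ### Compactness of states and orthonormal eigenbases -/

section Compact

variable {H : Type*} [NormedAddCommGroup H] [InnerProductSpace ℂ H]

theorem isCompactOperator_rankOne (x y : H) :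
    IsCompactOperator (InnerProductSpace.rankOne ℂ x y) := by
  have h : IsCompactOperator (innerSL ℂ y) :=
    isCompactOperator_of_locallyCompactSpace_dom (innerSL ℂ y)
  exact h.clm_comp (ContinuousLinearMap.toSpanSingleton ℂ x)

variable [CompleteSpace H]

/-- A self-adjoint operator with square-summable columns (a Hilbert-Schmidt operator) is compact. -/
theorem isCompactOperator_of_summable_norm_sq {ι : Type*} (b : HilbertBasis ι ℂ H)
    {A : H →L[ℂ] H} (hA : A.IsSymmetric) (hs : Summable fun i => ‖A (b i)‖ ^ 2) :
    IsCompactOperator A := by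
  classical
  -- Truncating to the coordinates in `F` leaves an error whose coefficients off `F` are `⟨A (b j),
  -- x⟩`. Parseval and Cauchy-Schwarz bound it by the tail of the sum, so `A` is a norm limit of
  -- finite-rank operators.
  have key : ∀ F : Finset ι, ‖A - ∑ i ∈ F, InnerProductSpace.rankOne ℂ (b i) (A (b i))‖
      ≤ √(∑' i : {i // i ∉ F}, ‖A (b i)‖ ^ 2) := by
    intro F
    refine ContinuousLinearMap.opNorm_le_bound _ (Real.sqrt_nonneg _) fun x => ?_
    set y := (A - ∑ i ∈ F, InnerProductSpace.rankOne ℂ (b i) (A (b i))) x with hy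
    have hcoef : ∀ j, inner ℂ (b j) y =
        (if j ∈ F then 0 else inner ℂ (A (b j)) x : ℂ) := by
      intro j
      have h1 : inner ℂ (b j) (A x) = inner ℂ (A (b j)) x := (hA _ _).symm
      simp only [hy, sub_apply, sum_apply,
        InnerProductSpace.rankOne_apply, inner_sub_right, inner_sum, inner_smul_right, h1,
        orthonormal_iff_ite.1 b.orthonormal]
      split_ifs with hj <;> simp [hj]
    set g : ι → ℝ := Set.indicator {i | i ∉ F} fun i => ‖A (b i)‖ ^ 2 with hg
    have hgs : Summable g := hs.indicator _
    have hg0 : ∀ i, 0 ≤ g i := fun i => Set.indicator_nonneg (fun _ _ => sq_nonneg _) i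
    have hsq : ‖y‖ ^ 2 ≤ (∑' i, g i) * ‖x‖ ^ 2 := by
      rw [← ENNReal.ofReal_le_ofReal_iff (mul_nonneg (tsum_nonneg hg0) (sq_nonneg _)),
        ← tsum_enorm_inner_sq b y, ← tsum_mul_right,
        ENNReal.ofReal_tsum_of_nonneg (fun i => mul_nonneg (hg0 i) (sq_nonneg _))
          (hgs.mul_right _)]
      refine ENNReal.tsum_le_tsum fun j => ENNReal.ofReal_le_ofReal ?_
      rw [hcoef, hg]
      by_cases hj : j ∈ F
      · simp [hj]
      · simp only [hj, if_false, Set.indicator, Set.mem_ofPred_eq, not_false_eq_true, if_true]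
        rw [← mul_pow]
        exact pow_le_pow_left₀ (norm_nonneg _) (norm_inner_le_norm _ _) 2
    have hsub : ∑' i : {i // i ∉ F}, ‖A (b i)‖ ^ 2 = ∑' i, g i :=
      tsum_subtype {i | i ∉ F} fun i => ‖A (b i)‖ ^ 2
    rw [hsub]
    calc ‖y‖ = √(‖y‖ ^ 2) := (Real.sqrt_sq (norm_nonneg _)).symm
      _ ≤ √((∑' i, g i) * ‖x‖ ^ 2) := Real.sqrt_le_sqrt hsq
      _ = √(∑' i, g i) * ‖x‖ := by
        rw [Real.sqrt_mul (tsum_nonneg hg0), Real.sqrt_sq (norm_nonneg _)]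
  have hlim : Filter.Tendsto (fun F : Finset ι => ∑ i ∈ F, InnerProductSpace.rankOne ℂ (b i) (A (b i)))
      Filter.atTop (nhds A) := by
    rw [tendsto_iff_norm_sub_tendsto_zero]
    have h0 := (Real.continuous_sqrt.tendsto 0).comp
      (tendsto_tsum_compl_atTop_zero fun i => ‖A (b i)‖ ^ 2)
    rw [Real.sqrt_zero] at h0
    refine squeeze_zero (fun _ => norm_nonneg _) (fun F => ?_) h0
    rw [norm_sub_rev]
    exact key F
  exact isCompactOperator_of_tendsto hlim (Filter.Eventually.of_forall fun F =>
    (compactOperator (RingHom.id ℂ) H H).sum_mem fun i _ => isCompactOperator_rankOne _ _)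

/-- Since `‖√T e‖² = ⟨e, T e⟩`, finite trace makes `√T` Hilbert-Schmidt, hence compact, and `T` is
its square. -/
theorem isCompactOperator_of_posTrace_ne_top {T : H →L[ℂ] H} (hT : 0 ≤ T) (h : posTrace T ≠ ∞) :
    IsCompactOperator T := by
  have hS : (CFC.sqrt T).IsSymmetric :=
    ((ContinuousLinearMap.nonneg_iff_isPositive _).1 (CFC.sqrt_nonneg T)).isSymmetric
  have hT2 : T = CFC.sqrt T * CFC.sqrt T := (CFC.sqrt_mul_sqrt_self T hT).symm
  have key : ∀ x : H, (inner ℂ x (T x)).re = ‖CFC.sqrt T x‖ ^ 2 := by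
    intro x
    have h : T x = CFC.sqrt T (CFC.sqrt T x) := by
      conv_lhs => rw [hT2]
      rfl
    have h' : inner ℂ x (CFC.sqrt T (CFC.sqrt T x)) = inner ℂ (CFC.sqrt T x) (CFC.sqrt T x) :=
      (hS _ _).symm
    rw [h, h', inner_self_eq_norm_sq_to_K]
    norm_cast
  have hc : IsCompactOperator (CFC.sqrt T : H →L[ℂ] H) := by
    refine isCompactOperator_of_summable_norm_sq (onb H) hS ?_
    unfold posTrace at h
    simp_rw [key] at h
    refine (ENNReal.summable_toReal h).congr fun i => ?_
    rw [ENNReal.toReal_ofReal (sq_nonneg _)]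
  have hcc : IsCompactOperator (CFC.sqrt T * CFC.sqrt T : H →L[ℂ] H) := hc.comp_clm (CFC.sqrt T)
  rwa [← hT2] at hcc

/-- A compact self-adjoint operator has an orthonormal eigenbasis adapted to its eigenspaces. -/
theorem exists_hilbertBasis_sigma_eigenspace {T : H →L[ℂ] H} (hT : IsCompactOperator T)
    (hT' : T.IsSymmetric) :
    ∃ (w : ∀ μ : ℂ, Set ↥(Module.End.eigenspace (T : H →ₗ[ℂ] H) μ))
      (e : ∀ μ : ℂ, HilbertBasis (w μ) ℂ (Module.End.eigenspace (T : H →ₗ[ℂ] H) μ))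
      (b : HilbertBasis (Σ μ, w μ) ℂ H), ∀ i, b i = e i.1 i.2 := by
  have hcl : ∀ μ : ℂ, CompleteSpace (Module.End.eigenspace (T : H →ₗ[ℂ] H) μ) := by
    intro μ
    have : IsClosed {x | T x = μ • x} := isClosed_eq T.continuous (continuous_const_smul μ)
    refine IsClosed.completeSpace_coe (hs := ?_)
    convert this using 1
    ext x
    simp
  choose w e he using fun μ : ℂ =>
    exists_hilbertBasis ℂ (Module.End.eigenspace (T : H →ₗ[ℂ] H) μ)
  have hon : Orthonormal ℂ fun i : Σ μ, w μ => ((e i.1 i.2 : Module.End.eigenspace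
      (T : H →ₗ[ℂ] H) i.1) : H) :=
    hT'.orthogonalFamily_eigenspaces.orthonormal_sigma_orthonormal fun μ => (e μ).orthonormal
  refine ⟨w, e, HilbertBasis.mkOfOrthogonalEqBot hon ?_, fun i => ?_⟩
  · rw [eq_bot_iff, ← ContinuousLinearMap.orthogonalComplement_iSup_eigenspaces_eq_bot hT hT',
      ← Submodule.iInf_orthogonal]
    -- A vector orthogonal to every chosen basis vector is orthogonal to each eigenspace, by
    -- expanding eigenvectors in the basis of their eigenspace.
    intro x hx
    rw [Submodule.mem_iInf]
    intro μ y hy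
    have h1 := (((e μ).hasSum_repr ⟨y, hy⟩).mapL
      (Module.End.eigenspace (T : H →ₗ[ℂ] H) μ).subtypeL).mapL (innerSL ℂ x)
    have hz : ∀ j : w μ, inner ℂ x (e μ j : H) = 0 := fun j =>
      inner_eq_zero_symm.1 (hx _ (Submodule.subset_span ⟨⟨μ, j⟩, rfl⟩))
    simp only [map_smul, Submodule.subtypeL_apply, innerSL_apply_apply, hz, smul_zero] at h1
    exact inner_eq_zero_symm.1 (h1.unique hasSum_zero)
  · rw [HilbertBasis.coe_mkOfOrthogonalEqBot]

end Compact

/-! ### Eigenvalues of positive compact operators with multiplicity -/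

section Spectral

theorem HilbertBasis.tsum_const_eq_finrank_mul {E : Type*} [NormedAddCommGroup E]
    [InnerProductSpace ℂ E] [FiniteDimensional ℂ E] {ι : Type*} (b : HilbertBasis ι ℂ E)
    (c : ℝ≥0∞) : ∑' _ : ι, c = (Module.finrank ℂ E : ℝ≥0∞) * c := by
  have : Finite ι := b.orthonormal.linearIndependent.finite
  have := Fintype.ofFinite ι
  rw [Module.finrank_eq_card_basis b.toOrthonormalBasis.toBasis]
  simp

variable {H : Type*} [NormedAddCommGroup H] [InnerProductSpace ℂ H]

theorem HilbertBasis.infinite_of_not_finiteDimensional {ι : Type*} (b : HilbertBasis ι ℂ H)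
    (h : ¬ FiniteDimensional ℂ H) : Infinite ι := by
  by_contra hι
  rw [not_infinite_iff_finite] at hι
  have := Fintype.ofFinite ι
  exact h b.toOrthonormalBasis.toBasis.finiteDimensional_of_finite

theorem ContinuousLinearMap.IsPositive.eigenvalue_eq_re {T : H →L[ℂ] H} (hT : T.IsPositive) {μ : ℂ}
    {x : H} (hx : x ≠ 0) (h : T x = μ • x) : μ = (μ.re : ℂ) ∧ 0 ≤ μ.re := by
  have hμ : Module.End.HasEigenvalue (T : H →ₗ[ℂ] H) μ :=
    Module.End.hasEigenvalue_of_hasEigenvector ⟨Module.End.mem_eigenspace_iff.2 h, hx⟩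
  have hre : μ = (μ.re : ℂ) :=
    (Complex.conj_eq_iff_re.1 (hT.isSymmetric.conj_eigenvalue_eq_self hμ)).symm
  refine ⟨hre, ?_⟩
  rw [hre] at hμ
  exact eigenvalue_nonneg_of_nonneg hμ fun y => hT.re_inner_nonneg_right y

/-- A positive compact operator is diagonal in some orthonormal basis, and the sum of the powers of
its diagonal entries is the sum over its eigenvalues with multiplicity. -/
theorem exists_hilbertBasis_diagonal.{u} {H : Type u} [NormedAddCommGroup H]
    [InnerProductSpace ℂ H] [CompleteSpace H] {Q : H →L[ℂ] H} (hQ : Q.IsPositive)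
    (hc : IsCompactOperator Q) : ∃ (ι : Type u) (b : HilbertBasis ι ℂ H) (c : ι → ℝ),
      (∀ i, 0 ≤ c i) ∧ (∀ i, Q (b i) = (c i : ℂ) • b i) ∧
      ∀ r : ℝ, 0 < r → ∑' i, ENNReal.ofReal (c i ^ r) = eigenvalueSum r Q := by
  obtain ⟨w, e, b, hb⟩ := exists_hilbertBasis_sigma_eigenspace hc hQ.isSymmetric
  have hbQ : ∀ i, Q (b i) = i.1 • b i := fun i => by
    rw [hb]
    exact Module.End.mem_eigenspace_iff.1 (e i.1 i.2).2
  have hev : ∀ i : Σ μ, w μ, i.1 = (i.1.re : ℂ) ∧ 0 ≤ i.1.re := fun i =>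
    hQ.eigenvalue_eq_re (b.orthonormal.ne_zero i) (hbQ i)
  refine ⟨Σ μ, w μ, b, fun i => i.1.re, fun i => (hev i).2, fun i => ?_, fun r hr => ?_⟩
  · rw [← (hev i).1]
    exact hbQ i
  · rw [ENNReal.tsum_sigma' fun i : Σ μ, w μ => ENNReal.ofReal (i.1.re ^ r), eigenvalueSum]
    have hinj : Function.Injective fun μ : {μ : ℝ // 0 < μ} => ((μ : ℝ) : ℂ) :=
      Complex.ofReal_injective.comp Subtype.val_injective
    -- Only positive real `μ` contribute: the kernel, possibly infinite-dimensional, drops out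
    -- because `0 ^ r = 0` for `r > 0`.
    rw [← hinj.tsum_eq]
    · refine tsum_congr fun μ => ?_
      have : FiniteDimensional ℂ (Module.End.eigenspace (Q : H →ₗ[ℂ] H) ((μ : ℝ) : ℂ)) :=
        Q.finite_dimensional_eigenspace hc _ (Complex.ofReal_ne_zero.2 μ.2.ne')
      exact (e ((μ : ℝ) : ℂ)).tsum_const_eq_finrank_mul (ENNReal.ofReal ((μ : ℝ) ^ r))
    · intro μ hμ
      obtain ⟨j, hj⟩ : ∃ j : w μ, ENNReal.ofReal (μ.re ^ r) ≠ 0 := by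
        by_contra! h
        exact hμ (ENNReal.tsum_eq_zero.2 h)
      obtain ⟨h1, h2⟩ := hev ⟨μ, j⟩
      have h3 : μ.re ≠ 0 := by
        intro h
        rw [h, Real.zero_rpow hr.ne', ENNReal.ofReal_zero] at hj
        exact hj rfl
      exact ⟨⟨μ.re, h2.lt_of_ne' h3⟩, h1.symm⟩

end Spectral

/-! ### States of infinite moment near a given state -/

section Density

/-- For `0 < r < 1` there are positive weights of sum one whose `r`-th powers are not summable. -/
theorem exists_weights_tsum_rpow_eq_top {r : ℝ} (hr0 : 0 < r) (hr1 : r < 1) :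
    ∃ s : ℕ → ℝ, (∀ n, 0 ≤ s n) ∧ HasSum s 1 ∧ ¬ Summable fun n => s n ^ r := by
  -- The exponent `1 / r > 1` gives convergence, and raising to the power `r` returns the harmonic
  -- series. The shift by one avoids the index zero.
  set u : ℕ → ℝ := fun n => (((n + 1 : ℕ) : ℝ) ^ (1 / r))⁻¹ with hu
  have hu0 : ∀ n, 0 < u n := fun n => by positivity
  have hus : Summable u :=
    (summable_nat_add_iff 1).2 (Real.summable_nat_rpow_inv.2 (one_lt_one_div hr0 hr1))
  have hS : 0 < ∑' n, u n := hus.tsum_pos (fun n => (hu0 n).le) 0 (hu0 0)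
  refine ⟨fun n => u n / ∑' n, u n, fun n => (div_pos (hu0 n) hS).le, ?_, fun h => ?_⟩
  · simpa [hS.ne'] using hus.hasSum.div_const (∑' n, u n)
  · have h1 : (fun n => (u n / ∑' n, u n) ^ r) =
        fun n => ((n + 1 : ℕ) : ℝ)⁻¹ / (∑' n, u n) ^ r := by
      funext n
      rw [Real.div_rpow (hu0 n).le hS.le, hu]
      simp only
      rw [Real.inv_rpow (by positivity), ← Real.rpow_mul (by positivity),
        one_div_mul_cancel hr0.ne', Real.rpow_one]
    rw [h1, summable_div_const_iff (Real.rpow_pos_of_pos hS r).ne'] at h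
    exact Real.not_summable_natCast_inv ((summable_nat_add_iff 1).1 h)

variable {H : Type*} [NormedAddCommGroup H] [InnerProductSpace ℂ H] [CompleteSpace H]

/-- An operator that is diagonal in a given orthonormal basis, with summable diagonal entries. -/
theorem exists_clm_diagonal {ι : Type*} (b : HilbertBasis ι ℂ H) {c : ι → ℝ} (hc : Summable c) :
    ∃ S : H →L[ℂ] H, ∀ i, S (b i) = (c i : ℂ) • b i := by
  -- The series converges absolutely in operator norm, each rank-one projection having norm one.
  have hs : Summable fun i => (c i : ℂ) • InnerProductSpace.rankOne ℂ (b i) (b i) := by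
    refine Summable.of_norm (hc.abs.congr fun i => ?_)
    simp [norm_smul, b.orthonormal.1 i]
  refine ⟨∑' i, (c i : ℂ) • InnerProductSpace.rankOne ℂ (b i) (b i), fun i => ?_⟩
  classical
  have h := hs.hasSum.mapL (ContinuousLinearMap.apply ℂ H (b i))
  refine h.unique ?_
  convert! hasSum_ite_eq i ((c i : ℂ) • b i) using 2 with j
  simp only [ContinuousLinearMap.apply_apply, smul_apply,
    InnerProductSpace.rankOne_apply, orthonormal_iff_ite.1 b.orthonormal]
  split_ifs with hj <;> simp [hj]

theorem exists_isState_schattenMoment_eq_top (hdim : ¬ FiniteDimensional ℂ H) {r : ℝ} (hr0 : 0 < r)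
    (hr1 : r < 1) {Q : H →L[ℂ] H} (hQ : IsState Q) {ε : ℝ≥0∞} (hε : 0 < ε) :
    ∃ Q' : H →L[ℂ] H, IsState Q' ∧ schattenMoment r Q' = ∞ ∧ traceNorm (Q' - Q) < ε := by
  have hQ0 : 0 ≤ Q := (ContinuousLinearMap.nonneg_iff_isPositive _).2 hQ.1
  obtain ⟨ι, b, c, hc0, hcQ, -⟩ := exists_hilbertBasis_diagonal hQ.1
    (isCompactOperator_of_posTrace_ne_top hQ0 (by simp [hQ.2]))
  have hc1 : ∑' i, ENNReal.ofReal (c i) = 1 := by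
    rw [← posTrace_eq_tsum_of_diagonal b hQ0 hcQ, hQ.2]
  have := b.infinite_of_not_finiteDimensional hdim
  obtain ⟨s, hs0, hs1, hsr⟩ := exists_weights_tsum_rpow_eq_top hr0 hr1
  let φ := Infinite.natEmbedding ι
  -- The weights sit on the image of `φ` and vanish elsewhere.
  set d : ι → ℝ := Function.extend φ s 0 with hd
  have hdφ : ∀ n, d (φ n) = s n := fun n => φ.injective.extend_apply s 0 n
  have hd0 : ∀ i, 0 ≤ d i := fun i => by
    by_cases h : ∃ n, φ n = i
    · obtain ⟨n, rfl⟩ := h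
      rw [hdφ]
      exact hs0 n
    · rw [hd, Function.extend_apply' _ _ _ h]
      rfl
  have hd1 : HasSum d 1 := by
    rwa [hd, hasSum_extend_zero φ.injective]
  have hd1' : ∑' i, ENNReal.ofReal (d i) = 1 := by
    rw [← ENNReal.ofReal_tsum_of_nonneg hd0 hd1.summable, hd1.tsum_eq, ENNReal.ofReal_one]
  obtain ⟨S, hS⟩ := exists_clm_diagonal b hd1.summable
  -- The factor 2 is the sum of the traces of `S` and `Q`, since `Q' - Q = t(S - Q)`.
  obtain ⟨t, ht0, ht1, htε⟩ : ∃ t : ℝ, 0 < t ∧ t < 1 ∧ ENNReal.ofReal t * 2 < ε := by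
    obtain ⟨δ, -, hδ0, hδ⟩ := ENNReal.lt_iff_exists_real_btwn.1 hε
    have hδ' : 0 < δ := ENNReal.ofReal_pos.1 hδ0
    refine ⟨min (δ / 2) (1 / 2), by positivity, by
      linarith [min_le_right (δ / 2) (1 / 2 : ℝ)], lt_of_le_of_lt ?_ hδ⟩
    rw [← ENNReal.ofReal_ofNat, ← ENNReal.ofReal_mul (by positivity)]
    exact ENNReal.ofReal_le_ofReal (by linarith [min_le_left (δ / 2) (1 / 2 : ℝ)])
  set Q' : H →L[ℂ] H := ((1 - t : ℝ) : ℂ) • Q + (t : ℂ) • S with hQ'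
  have h1t : 0 ≤ 1 - t := by linarith
  have hcQ' : ∀ i, Q' (b i) = (((1 - t) * c i + t * d i : ℝ) : ℂ) • b i := fun i => by
    simp only [hQ', add_apply, smul_apply, hcQ, hS, smul_smul, ← add_smul]
    push_cast
    rfl
  have hpos : ∀ i, 0 ≤ (1 - t) * c i + t * d i := fun i =>
    add_nonneg (mul_nonneg h1t (hc0 i)) (mul_nonneg ht0.le (hd0 i))
  have hQ'pos : Q'.IsPositive := isPositive_of_diagonal b hpos hcQ'
  have hQ'0 : 0 ≤ Q' := (ContinuousLinearMap.nonneg_iff_isPositive _).2 hQ'pos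
  refine ⟨Q', ⟨hQ'pos, ?_⟩, ?_, ?_⟩
  · rw [posTrace_eq_tsum_of_diagonal b hQ'0 hcQ']
    have : ∀ i, ENNReal.ofReal ((1 - t) * c i + t * d i) =
        ENNReal.ofReal (1 - t) * ENNReal.ofReal (c i) +
          ENNReal.ofReal t * ENNReal.ofReal (d i) := fun i => by
      rw [ENNReal.ofReal_add (mul_nonneg h1t (hc0 i)) (mul_nonneg ht0.le (hd0 i)),
        ENNReal.ofReal_mul h1t, ENNReal.ofReal_mul ht0.le]
    simp_rw [this]
    rw [ENNReal.tsum_add, ENNReal.tsum_mul_left, ENNReal.tsum_mul_left, hc1, hd1', mul_one, mul_one,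
      ← ENNReal.ofReal_add h1t ht0.le]
    simp
  · rw [schattenMoment_eq_tsum_of_diagonal b hQ'0 hcQ' hr0.le]
    by_contra hne
    -- A finite moment would be summable along `φ`, where its terms dominate `t ^ r * s n ^ r`.
    have hsum := (ENNReal.summable_toReal hne).comp_injective φ.injective
    refine hsr ((summable_mul_left_iff (Real.rpow_pos_of_pos ht0 r).ne').1
      (Summable.of_nonneg_of_le (fun n => ?_) (fun n => ?_) hsum))
    · exact mul_nonneg (Real.rpow_nonneg ht0.le r) (Real.rpow_nonneg (hs0 n) r)
    · rw [Function.comp_apply, ENNReal.toReal_ofReal (Real.rpow_nonneg (hpos _) r),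
        ← Real.mul_rpow ht0.le (hs0 n), hdφ]
      exact Real.rpow_le_rpow (mul_nonneg ht0.le (hs0 n))
        (le_add_of_nonneg_left (mul_nonneg h1t (hc0 _))) hr0.le
  · have hcD : ∀ i, (Q' - Q) (b i) = ((t * (d i - c i) : ℝ) : ℂ) • b i := fun i => by
      rw [sub_apply, hcQ', hcQ, ← sub_smul, ← Complex.ofReal_sub]
      congr 2
      ring
    rw [traceNorm_eq_tsum_of_diagonal b (hQ'pos.isSelfAdjoint.sub hQ.1.isSelfAdjoint) hcD]
    refine lt_of_le_of_lt ?_ htε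
    calc ∑' i, ENNReal.ofReal |t * (d i - c i)|
        ≤ ∑' i, ENNReal.ofReal t * (ENNReal.ofReal (d i) + ENNReal.ofReal (c i)) := by
          refine ENNReal.tsum_le_tsum fun i => ?_
          rw [← ENNReal.ofReal_add (hd0 i) (hc0 i), ← ENNReal.ofReal_mul ht0.le, abs_mul,
            abs_of_pos ht0]
          refine ENNReal.ofReal_le_ofReal (mul_le_mul_of_nonneg_left ?_ ht0.le)
          rw [abs_le]
          constructor <;> linarith [hd0 i, hc0 i]
      _ = ENNReal.ofReal t * 2 := by
          rw [ENNReal.tsum_mul_left, ENNReal.tsum_add, hd1', hc1, one_add_one_eq_two]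

end Density

theorem proposition1 {H : Type*} [NormedAddCommGroup H] [InnerProductSpace ℂ H] [CompleteSpace H]
    [TopologicalSpace.SeparableSpace H] (hdim : ¬ FiniteDimensional ℂ H)
    (r : ℝ) (hr0 : 0 < r) (hr1 : r < 1) :
    (∀ Q : H →L[ℂ] H, IsState Q →
      schattenMoment r Q = posTrace (Q ^ r) ∧ posTrace (Q ^ r) = eigenvalueSum r Q) ∧
    (∀ Q : H →L[ℂ] H, IsState Q → ∀ ε : ℝ≥0∞, 0 < ε →
      ∃ Q' : H →L[ℂ] H, IsState Q' ∧ schattenMoment r Q' = ∞ ∧ traceNorm (Q' - Q) < ε) := by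
  refine ⟨fun Q hQ => ⟨schattenMoment_eq_posTrace r Q, ?_⟩,
    fun Q hQ ε hε => exists_isState_schattenMoment_eq_top hdim hr0 hr1 hQ hε⟩
  have hQ0 : 0 ≤ Q := (ContinuousLinearMap.nonneg_iff_isPositive _).2 hQ.1
  obtain ⟨ι, b, c, -, hcQ, hsum⟩ := exists_hilbertBasis_diagonal hQ.1
    (isCompactOperator_of_posTrace_ne_top hQ0 (by simp [hQ.2]))
  rw [← schattenMoment_eq_posTrace, schattenMoment_eq_tsum_of_diagonal b hQ0 hcQ hr0.le,
    hsum r hr0]
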